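/- Conventions: a complex torus is $E/\Lambda$ with $E$ a finite dimensional complex vector space and $\Lambda=H_1(E/\Lambda,\mathbb Z)$ a full lattice in $E$; morphisms of complex tori are holomorphic group homomorphisms; an isogeny is a surjective morphism with finite kernel. A polarization on $E/\Lambda$ is an integer valued alternating form $L$ on $\Lambda$ which is the imaginary part of a positive definite hermitian form on $E$; an abelian variety is a complex torus which admits a polarization. Forms are pulled back along a morphism $h$ by $h^*L=L(h_*\,\cdot,h_*\,\cdot)$, with $h_*$ the induced map on $H_1$. An abelian subvariety of $V$ is an abelian variety $X$ with an embedding (injective morphism) $X\hookrightarrow V$. Two abelian subvarieties $X,X'$ of a polarized abelian variety $(V,L_V)$ are complementary if the sum of the embeddings $s:X\times X'\to V$ is an isogeny and $s^*L_V=p^*L_X+p'^*L_{X'}$, where $L_X,L_{X'}$ are the forms induced by $L_V$ on $X,X'$ and $p,p'$ are the two projections of $X\times X'$. Proposition. Let $(V,L_V)$ and $(W,L_W)$ be polarized complex abelian varieties and let $f:V\to W$ be a morphism (not assumed to respect the polarizations). Then there are complementary abelian subvarieties $X,X'\subset V$ and complementary abelian subvarieties $Y,Y'\subset W$, and an isogeny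 $g:X\to Y$, such that the diagram $$\begin{array}{ccc} X\times X' & \longrightarrow & V\\ {\scriptstyle g\times 0}\big\downarrow & & \big\downarrow{\scriptstyle f}\\ Y\times Y' & \longrightarrow & W\end{array}$$ commutes, where the horizontal arrows are the isogenies given by the sums of the embeddings. The diagram is uniquely determined by $f$, $L_V$ and $L_W$: for any two such data $(X_1,X_1',Y_1,Y_1',g_1)$ and $(X_2,X_2',Y_2,Y_2',g_2)$ there are isomorphisms $a:X_1\to X_2$, $a':X_1'\to X_2'$, $b:Y_1\to Y_2$, $b':Y_1'\to Y_2'$ compatible with the embeddings into $V$ and $W$ (so that the subvarieties coincide as subsets), and $g_2\circ a=b\circ g_1$. -/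

import Mathlib

open Filter Topology

universe u v w

/-- A complex torus `E ⧸ Λ`: a finite dimensional complex vector space `E` (`space`) together with
a full lattice `Λ ⊆ E` (`lattice`), that is a discrete subgroup spanning `E` over `ℝ`.
The first homology `H₁(E ⧸ Λ, ℤ)` is `Λ`. -/
structure ComplexTorus : Type (u + 1) where
  space : Type u
  [normedAddCommGroup : NormedAddCommGroup space]
  [normedSpace : NormedSpace ℂ space]
  [finiteDimensional : FiniteDimensional ℂ space]
  lattice : Submodule ℤ space
  [discreteTopology : DiscreteTopology lattice]
  [isZLattice : IsZLattice ℝ lattice]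

attribute [instance] ComplexTorus.normedAddCommGroup ComplexTorus.normedSpace
  ComplexTorus.finiteDimensional ComplexTorus.discreteTopology ComplexTorus.isZLattice

namespace ComplexTorus

/-- The group of points `E ⧸ Λ`. -/
abbrev Point (X : ComplexTorus.{u}) : Type u := X.space ⧸ X.lattice

/-- The universal covering `E → E ⧸ Λ`. -/
abbrev proj (X : ComplexTorus.{u}) : X.space →ₗ[ℤ] X.Point := X.lattice.mkQ

/-- A map of complex tori is holomorphic if locally around every point it lifts to a holomorphic
map of the universal coverings (local sections of `E → E ⧸ Λ` being the charts). -/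
def IsHolomorphic {X : ComplexTorus.{u}} {Y : ComplexTorus.{v}} (f : X.Point → Y.Point) : Prop :=
  ∀ x : X.space, ∃ F : X.space → Y.space,
    ∀ᶠ y in 𝓝 x, DifferentiableAt ℂ F y ∧ f (X.proj y) = Y.proj (F y)

/-- A morphism of complex tori: a holomorphic group homomorphism. -/
structure Hom (X : ComplexTorus.{u}) (Y : ComplexTorus.{v}) where
  toAddMonoidHom : X.Point →+ Y.Point
  holomorphic : IsHolomorphic toAddMonoidHom

namespace Hom

variable {X : ComplexTorus.{u}} {Y : ComplexTorus.{v}} {Z : ComplexTorus.{w}}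

instance : FunLike (Hom X Y) X.Point Y.Point where
  coe f := f.toAddMonoidHom
  coe_injective f g h := by
    cases f; cases g; congr; exact DFunLike.coe_injective h

/-- A `ℂ`-linear map which maps the lattice into the lattice induces a morphism of tori. -/
def ofLinear (A : X.space →ₗ[ℂ] Y.space) (hA : ∀ x ∈ X.lattice, A x ∈ Y.lattice) : Hom X Y where
  toAddMonoidHom := (X.lattice.mapQ Y.lattice (A.restrictScalars ℤ) hA).toAddMonoidHom
  holomorphic _ := ⟨A, Eventually.of_forall fun _ =>
    ⟨(LinearMap.toContinuousLinearMap A).differentiableAt, rfl⟩⟩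

/-- The identity morphism. -/
def id (X : ComplexTorus.{u}) : Hom X X where
  toAddMonoidHom := AddMonoidHom.id _
  holomorphic _ := ⟨_root_.id, Eventually.of_forall fun _ => ⟨differentiableAt_id, rfl⟩⟩

/-- Composition of morphisms. -/
def comp (g : Hom Y Z) (f : Hom X Y) : Hom X Z where
  toAddMonoidHom := g.toAddMonoidHom.comp f.toAddMonoidHom
  holomorphic x := by
    obtain ⟨F, hF⟩ := f.holomorphic x
    obtain ⟨G, hG⟩ := g.holomorphic (F x)
    refine ⟨G ∘ F, ?_⟩
    filter_upwards [hF, hF.self_of_nhds.1.continuousAt.eventually hG] with y hy hy'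
    exact ⟨hy'.1.comp y hy.1, (congrArg g.toAddMonoidHom hy.2).trans hy'.2⟩

instance : Zero (Hom X Y) where
  zero := ⟨0, fun _ => ⟨0, Eventually.of_forall fun _ =>
    ⟨differentiableAt_const 0, by simp⟩⟩⟩

instance : Add (Hom X Y) where
  add f g :=
  { toAddMonoidHom := f.toAddMonoidHom + g.toAddMonoidHom
    holomorphic := fun x => by
      obtain ⟨F, hF⟩ := f.holomorphic x
      obtain ⟨G, hG⟩ := g.holomorphic x
      refine ⟨F + G, ?_⟩
      filter_upwards [hF, hG] with y hy hy'
      exact ⟨hy.1.add hy'.1, by simp only [AddMonoidHom.add_apply, hy.2, hy'.2, Pi.add_apply, map_add]⟩ }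

/-- Every morphism of tori is induced by a `ℂ`-linear map of the universal coverings. -/
theorem exists_analyticRep (f : Hom X Y) :
    ∃ A : X.space →ₗ[ℂ] Y.space, ∀ x, f (X.proj x) = Y.proj (A x) := by
  obtain ⟨F, hF⟩ := f.holomorphic 0
  have hd : DifferentiableAt ℂ F 0 := hF.self_of_nhds.1
  have h0 : F 0 ∈ Y.lattice := by
    have := hF.self_of_nhds.2
    rw [map_zero, map_zero] at this
    exact (Submodule.Quotient.mk_eq_zero _).1 this.symm
  obtain ⟨ε, hε, hsmall⟩ : ∃ ε > 0, ∀ v ∈ Y.lattice, ‖v‖ < ε → v = 0 := by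
    have h1 : ({0} : Set Y.lattice) ∈ 𝓝 0 := (isOpen_discrete _).mem_nhds rfl
    obtain ⟨ε, hε, h2⟩ := Metric.mem_nhds_iff.1 h1
    refine ⟨ε, hε, fun v hv hn => ?_⟩
    have : (⟨v, hv⟩ : Y.lattice) ∈ Metric.ball (0 : Y.lattice) ε := by
      simpa [Metric.mem_ball, dist_zero_right] using hn
    simpa using h2 this
  have hc : ∀ᶠ y in 𝓝 (0 : X.space), ‖F y - F 0‖ < ε / 3 := by
    have := hd.continuousAt.eventually (Metric.ball_mem_nhds (F 0) (by positivity : 0 < ε / 3))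
    filter_upwards [this] with y hy
    simpa [dist_eq_norm] using hy
  obtain ⟨δ, hδ, hball⟩ := Metric.eventually_nhds_iff.1 (hF.and hc)
  set G : X.space → Y.space := fun y => F y - F 0 with hG
  have hGproj : ∀ y : X.space, ‖y‖ < δ → f (X.proj y) = Y.proj (G y) := by
    intro y hy
    have h1 := (hball (y := y) (by simpa using hy)).1.2
    have h2 : Y.proj (F 0) = 0 := (Submodule.Quotient.mk_eq_zero _).2 h0
    rw [hG, map_sub, h2, sub_zero]
    exact h1
  have hhalf_lt : ∀ y : X.space, ‖y‖ < δ → ‖(2⁻¹ : ℂ) • y‖ < δ := by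
    intro y hy
    have := norm_nonneg y
    rw [norm_smul]
    norm_num
    linarith
  have hhalf : ∀ y : X.space, ‖y‖ < δ → G y = (2 : ℂ) • G ((2⁻¹ : ℂ) • y) := by
    intro y hy
    have hy' := hhalf_lt y hy
    have h1 := (hball (y := y) (by simpa using hy)).2
    have h2 := (hball (y := (2⁻¹ : ℂ) • y) (by simpa using hy')).2
    have hm : G y - (2 : ℂ) • G ((2⁻¹ : ℂ) • y) ∈ Y.lattice := by
      rw [← Submodule.Quotient.mk_eq_zero, ← Submodule.mkQ_apply, map_sub, two_smul, map_add]
      change Y.proj (G y) - (Y.proj _ + Y.proj _) = 0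
      rw [← hGproj _ hy, ← hGproj _ hy', sub_eq_zero]
      have : y = (2⁻¹ : ℂ) • y + (2⁻¹ : ℂ) • y := by rw [← add_smul]; norm_num
      conv_lhs => rw [this]
      rw [map_add]
      exact map_add f.toAddMonoidHom _ _
    refine sub_eq_zero.1 (hsmall _ hm ?_)
    calc ‖G y - (2 : ℂ) • G ((2⁻¹ : ℂ) • y)‖ ≤ ‖G y‖ + ‖(2 : ℂ) • G ((2⁻¹ : ℂ) • y)‖ :=
          norm_sub_le _ _
      _ = ‖G y‖ + 2 * ‖G ((2⁻¹ : ℂ) • y)‖ := by rw [norm_smul]; norm_num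
      _ < ε := by simp only [hG]; linarith
  have hpow : ∀ (k : ℕ) (y : X.space), ‖y‖ < δ → G y = (2 : ℂ) ^ k • G (((2 : ℂ) ^ k)⁻¹ • y) := by
    intro k
    induction k with
    | zero => intro y _; simp
    | succ k ih =>
      intro y hy
      rw [hhalf y hy, ih _ (hhalf_lt y hy), smul_smul, smul_smul, pow_succ', mul_inv, mul_comm
        ((2 : ℂ)⁻¹)]
  have hGd : HasFDerivAt G (fderiv ℂ F 0) 0 := hd.hasFDerivAt.sub_const _
  have hlin : ∀ y : X.space, ‖y‖ < δ → G y = fderiv ℂ F 0 y := by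
    intro y hy
    have ht : Tendsto (fun n : ℕ => ‖(2 : ℂ) ^ n‖) atTop atTop := by
      simpa using tendsto_pow_atTop_atTop_of_one_lt (one_lt_two : (1 : ℝ) < 2)
    have hl := hGd.lim y ht
    refine tendsto_nhds_unique (tendsto_const_nhds.congr fun n => ?_) hl
    rw [hpow n y hy]
    simp [hG]
  refine ⟨(fderiv ℂ F 0 : X.space →L[ℂ] Y.space), fun x => ?_⟩
  obtain ⟨n, hn⟩ := exists_nat_gt (‖x‖ / δ)
  have hn0 : (0 : ℝ) < n := lt_of_le_of_lt (by positivity) hn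
  have hnC : (n : ℂ) ≠ 0 := by exact_mod_cast hn0.ne'
  have hlt : ‖(n : ℂ)⁻¹ • x‖ < δ := by
    rw [norm_smul, norm_inv, Complex.norm_natCast, inv_mul_lt_iff₀ hn0, mul_comm]
    rw [div_lt_iff₀ hδ] at hn
    linarith
  have hx : x = n • ((n : ℂ)⁻¹ • x) := by
    rw [← Nat.cast_smul_eq_nsmul ℂ, smul_smul, mul_inv_cancel₀ hnC, one_smul]
  have key : f (X.proj ((n : ℂ)⁻¹ • x)) = Y.proj (fderiv ℂ F 0 ((n : ℂ)⁻¹ • x)) := by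
    rw [hGproj _ hlt, hlin _ hlt]
  conv_lhs => rw [hx]
  conv_rhs => rw [hx]
  rw [map_nsmul]
  refine (map_nsmul f.toAddMonoidHom n _).trans ?_
  rw [show f.toAddMonoidHom (X.proj ((n : ℂ)⁻¹ • x)) = _ from key, map_nsmul, map_nsmul]
  rfl

/-- The analytic representation of a morphism `f : E ⧸ Λ → E' ⧸ Λ'`: the `ℂ`-linear lift `E → E'`
of `f`. It is unique by `analyticRep_unique`. -/
noncomputable def analyticRep (f : Hom X Y) : X.space →ₗ[ℂ] Y.space :=
  f.exists_analyticRep.choose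

theorem analyticRep_spec (f : Hom X Y) (x : X.space) :
    f (X.proj x) = Y.proj (f.analyticRep x) :=
  f.exists_analyticRep.choose_spec x

theorem analyticRep_unique (f : Hom X Y) (A : X.space →ₗ[ℂ] Y.space)
    (hA : ∀ x, f (X.proj x) = Y.proj (A x)) : A = f.analyticRep := by
  have hmem : ∀ x, (A - f.analyticRep) x ∈ Y.lattice := fun x => by
    rw [LinearMap.sub_apply, ← Submodule.Quotient.mk_eq_zero, ← Submodule.mkQ_apply, map_sub]
    exact sub_eq_zero.2 ((hA x).symm.trans (f.analyticRep_spec x))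
  rw [← sub_eq_zero]
  ext x
  have hc : Continuous fun t : ℝ => (⟨(A - f.analyticRep) ((t : ℂ) • x), hmem _⟩ : Y.lattice) :=
    ((LinearMap.continuous_of_finiteDimensional (A - f.analyticRep)).comp
      (Complex.continuous_ofReal.smul continuous_const)).subtype_mk _
  have h := congrArg Subtype.val (PreconnectedSpace.constant inferInstance hc (x := 1) (y := 0))
  simpa using h

theorem analyticRep_mem (f : Hom X Y) (x : X.space) (hx : x ∈ X.lattice) :
    f.analyticRep x ∈ Y.lattice := by
  have h := f.analyticRep_spec x
  have h0 : X.proj x = 0 := (Submodule.Quotient.mk_eq_zero _).2 hx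
  rw [h0] at h
  exact (Submodule.Quotient.mk_eq_zero _).1 (h.symm.trans (map_zero f.toAddMonoidHom))

/-- The homomorphism `f_* : H₁(X, ℤ) → H₁(Y, ℤ)` induced by a morphism `f : X → Y`. -/
noncomputable def homology (f : Hom X Y) : X.lattice →ₗ[ℤ] Y.lattice :=
  (f.analyticRep.restrictScalars ℤ).restrict f.analyticRep_mem

/-- The pullback `f^* L` of a bilinear form `L` on `H₁(Y, ℤ)` to `H₁(X, ℤ)`. -/
noncomputable def pullback (f : Hom X Y) (L : LinearMap.BilinForm ℤ Y.lattice) :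
    LinearMap.BilinForm ℤ X.lattice :=
  L.compl₁₂ f.homology f.homology

/-- An isogeny is a surjective morphism with finite kernel. -/
def IsIsogeny (f : Hom X Y) : Prop :=
  Function.Surjective f ∧ (f.toAddMonoidHom.ker : Set X.Point).Finite

end Hom

/-- Isomorphisms of complex tori. -/
structure Iso (X : ComplexTorus.{u}) (Y : ComplexTorus.{v}) where
  hom : Hom X Y
  inv : Hom Y X
  hom_inv : inv.comp hom = Hom.id X
  inv_hom : hom.comp inv = Hom.id Y

section prod

variable (X : ComplexTorus.{u}) (Y : ComplexTorus.{v})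

/-- The product lattice is discrete. -/
theorem discreteTopology_prod : DiscreteTopology (X.lattice.prod Y.lattice) := by
  let φ : X.lattice.prod Y.lattice → X.lattice × Y.lattice :=
    fun p => (⟨p.1.1, p.2.1⟩, ⟨p.1.2, p.2.2⟩)
  have hφ : Continuous φ := by fun_prop
  have hi : Function.Injective φ := by
    rintro ⟨⟨a, b⟩, _⟩ ⟨⟨c, d⟩, _⟩ h
    simpa [φ] using h
  exact DiscreteTopology.of_continuous_injective hφ hi

/-- The product lattice spans. -/
theorem isZLattice_prod :
    have := discreteTopology_prod X Y
    IsZLattice ℝ (X.lattice.prod Y.lattice) := by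
  have := discreteTopology_prod X Y
  refine ⟨?_⟩
  have h := Submodule.span_prod_eq (R := ℝ) (s := (X.lattice : Set X.space))
    (t := (Y.lattice : Set Y.space)) X.lattice.zero_mem Y.lattice.zero_mem
  rw [Submodule.prod_coe, h, IsZLattice.span_top, IsZLattice.span_top, Submodule.prod_top]

/-- The product of two complex tori. -/
noncomputable abbrev prod : ComplexTorus.{max u v} where
  space := X.space × Y.space
  lattice := X.lattice.prod Y.lattice
  discreteTopology := discreteTopology_prod X Y
  isZLattice := isZLattice_prod X Y

end prod

namespace Hom

section

variable (X : ComplexTorus.{u}) (Y : ComplexTorus.{v})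

/-- The first projection `X × Y → X`. -/
noncomputable def fst : Hom (X.prod Y) X := ofLinear (LinearMap.fst ℂ X.space Y.space) fun _ h => h.1

/-- The second projection `X × Y → Y`. -/
noncomputable def snd : Hom (X.prod Y) Y := ofLinear (LinearMap.snd ℂ X.space Y.space) fun _ h => h.2

/-- The inclusion `X → X × Y`, `x ↦ (x, 0)`. -/
noncomputable def inl : Hom X (X.prod Y) :=
  ofLinear (LinearMap.inl ℂ X.space Y.space) fun _ h => ⟨h, Y.lattice.zero_mem⟩

/-- The inclusion `Y → X × Y`, `y ↦ (0, y)`. -/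
noncomputable def inr : Hom Y (X.prod Y) :=
  ofLinear (LinearMap.inr ℂ X.space Y.space) fun _ h => ⟨X.lattice.zero_mem, h⟩

end

/-- The sum `X × X' → V`, `(x, x') ↦ e x + e' x'`. -/
noncomputable def sum {X X' V : ComplexTorus.{u}} (e : Hom X V) (e' : Hom X' V) : Hom (X.prod X') V :=
  e.comp (fst X X') + e'.comp (snd X X')

/-- The product `X × X' → Y × Y'`, `(x, x') ↦ (g x, g' x')`. -/
noncomputable def prodMap {X X' : ComplexTorus.{u}} {Y Y' : ComplexTorus.{v}} (g : Hom X Y) (g' : Hom X' Y') :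
    Hom (X.prod X') (Y.prod Y') :=
  (inl Y Y').comp (g.comp (fst X X')) + (inr Y Y').comp (g'.comp (snd X X'))

end Hom

/-- A polarization on a complex torus `E ⧸ Λ`: an integral bilinear form on `H₁ = Λ` which is the
imaginary part of a positive definite hermitian form on `E` (in particular it is alternating). -/
structure Polarization (X : ComplexTorus.{u}) where
  form : LinearMap.BilinForm ℤ X.lattice
  exists_hermitian : ∃ H : X.space →ₗ[ℂ] X.space →ₗ⋆[ℂ] ℂ,
    (∀ x y, H y x = starRingEnd ℂ (H x y)) ∧ (∀ x, x ≠ 0 → 0 < (H x x).re) ∧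
    ∀ a b : X.lattice, (H a b).im = form a b

/-- A complex torus is an abelian variety if it admits a polarization. -/
def IsAbelianVariety (X : ComplexTorus.{u}) : Prop := Nonempty X.Polarization

/-- An abelian subvariety of `V`: an abelian variety with an embedding into `V`. -/
structure AbelianSubvariety (V : ComplexTorus.{u}) where
  torus : ComplexTorus.{u}
  isAbelianVariety : torus.IsAbelianVariety
  incl : Hom torus V
  incl_injective : Function.Injective incl

namespace AbelianSubvariety

variable {V : ComplexTorus.{u}}

/-- Two abelian subvarieties `X, X'` of the polarized abelian variety `(V, L)` are complementary if
the sum `s : X × X' → V` is an isogeny and `s^* L = p^* L_X + p'^* L_X'`, where `L_X`, `L_X'` are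
the polarizations induced by `L` and `p, p'` are the projections. -/
def AreComplementary (L : V.Polarization) (X X' : AbelianSubvariety V) : Prop :=
  (X.incl.sum X'.incl).IsIsogeny ∧
  (X.incl.sum X'.incl).pullback L.form =
    (Hom.fst X.torus X'.torus).pullback (X.incl.pullback L.form) +
    (Hom.snd X.torus X'.torus).pullback (X'.incl.pullback L.form)

end AbelianSubvariety

/-- A Poincaré decomposition of a morphism `f : V → W` of polarized abelian varieties. -/
structure PoincareDecomposition {V : ComplexTorus.{u}} {W : ComplexTorus.{v}}
    (LV : V.Polarization) (LW : W.Polarization) (f : Hom V W) where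
  X : AbelianSubvariety V
  X' : AbelianSubvariety V
  Y : AbelianSubvariety W
  Y' : AbelianSubvariety W
  complementary_domain : AbelianSubvariety.AreComplementary LV X X'
  complementary_codomain : AbelianSubvariety.AreComplementary LW Y Y'
  g : Hom X.torus Y.torus
  isIsogeny_g : g.IsIsogeny
  comm : f.comp (X.incl.sum X'.incl) = (Y.incl.sum Y'.incl).comp (g.prodMap 0)

end ComplexTorus

/-!
Every question about tori is translated into linear algebra through the analytic representation
of a morphism, the `ℂ`-linear lift to the universal coverings (tangent spaces).

A morphism is an isogeny if its analytic representation is bijective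
(`Hom.isIsogeny_of_bijective_analyticRep`), and conversely finite kernel and surjectivity give
injectivity and surjectivity of the analytic representation, because complex vector spaces are
uncountable and lattices are countable. A complex subspace is the tangent space of a subtorus as
soon as it is spanned over `ℝ` by lattice vectors (`IsRational`). Kernels of maps respecting
lattices have this property by rank counting (`span_lattice_inf_ker`), and so do images, and
orthogonal complements for a polarization, which are kernels of integral linear forms.
Two abelian subvarieties are complementary exactly when their tangent spaces are orthogonal
complements of each other (`AbelianSubvariety.areComplementary_iff`).

Hence, with `A` the analytic representation of `f`, the subspaces `(ker A)ᗮ`, `ker A`, `im A` and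
`(im A)ᗮ` are tangent spaces of abelian subvarieties `X`, `X'`, `Y`, `Y'`, and `A` restricts to an
isomorphism `(ker A)ᗮ → im A`, which yields the isogeny `g`. In any decomposition the square
forces the tangent space of `X'` to be `ker A` and that of `Y` to be `im A`; those of `X` and `Y'`
are then the orthogonal complements. An embedding is determined by its tangent space up to a
unique isomorphism (`Hom.exists_iso_of_range_eq`), which gives uniqueness.
-/

/-! ### Lattices -/

section Lattice

variable {E F : Type*} [NormedAddCommGroup E] [NormedSpace ℝ E] [FiniteDimensional ℝ E]
  [NormedAddCommGroup F] [NormedSpace ℝ F] [FiniteDimensional ℝ F]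

/-- The rank of a discrete subgroup is the dimension of its real span. -/
theorem finrank_span_real_eq_finrank_int (L : Submodule ℤ E) [hL : DiscreteTopology L] :
    Module.finrank ℝ (Submodule.span ℝ (L : Set E)) = Module.finrank ℤ L := by
  have h : DiscreteTopology (Submodule.span ℤ (L : Set E)) := by
    rwa [Submodule.span_eq]
  have := Real.finrank_eq_int_finrank_of_discrete h
  rwa [Set.finrank, Set.finrank, Submodule.span_eq] at this

/-- The kernel of a real linear map between spaces with lattices which maps one lattice into the
other is spanned by lattice vectors: the image of the lattice is again discrete, so that rank and
dimension agree for the image, hence for the kernel. -/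
theorem span_lattice_inf_ker (L : Submodule ℤ E) [DiscreteTopology L] [IsZLattice ℝ L]
    (M : Submodule ℤ F) [DiscreteTopology M] (T : E →ₗ[ℝ] F) (hT : ∀ x ∈ L, T x ∈ M) :
    Submodule.span ℝ {x | x ∈ L ∧ T x = 0} = LinearMap.ker T := by
  set T₀ : L →ₗ[ℤ] F := (T.restrictScalars ℤ) ∘ₗ L.subtype with hT₀
  have hrange : ∀ y ∈ LinearMap.range T₀, y ∈ M := by
    rintro _ ⟨x, rfl⟩
    exact hT x x.2
  have : DiscreteTopology (LinearMap.range T₀) :=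
    DiscreteTopology.of_continuous_injective
      (f := fun y : LinearMap.range T₀ => (⟨y, hrange y y.2⟩ : M)) (by fun_prop)
      fun a b h => Subtype.ext (congrArg (fun z : M => (z : F)) h)
  set K : Submodule ℤ E := (LinearMap.ker T₀).map L.subtype with hK
  have hKL : ∀ y ∈ K, y ∈ L := by
    rintro _ ⟨x, -, rfl⟩
    exact x.2
  have : DiscreteTopology K :=
    DiscreteTopology.of_continuous_injective
      (f := fun y : K => (⟨y, hKL y y.2⟩ : L)) (by fun_prop)
      fun a b h => Subtype.ext (congrArg (fun z : L => (z : E)) h)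
  have hKset : {x | x ∈ L ∧ T x = 0} = (K : Set E) := by
    ext x
    constructor
    · rintro ⟨h, h'⟩
      exact ⟨⟨x, h⟩, h', rfl⟩
    · rintro ⟨y, hy, rfl⟩
      exact ⟨y.2, hy⟩
  have hspan : Submodule.span ℝ (LinearMap.range T₀ : Set F) = LinearMap.range T := by
    have : (LinearMap.range T₀ : Set F) = T '' L := by
      ext y
      constructor
      · rintro ⟨x, rfl⟩
        exact ⟨x, x.2, rfl⟩
      · rintro ⟨x, hx, rfl⟩
        exact ⟨⟨x, hx⟩, rfl⟩
    rw [this, ← Submodule.map_span, IsZLattice.span_top, Submodule.map_top]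
  -- Compare rank-nullity for `T₀` over `ℤ` with rank-nullity for `T` over `ℝ`: the total ranks and
  -- the ranks of the images agree.
  have h1 := (LinearMap.ker T₀).finrank_quotient_add_finrank
  rw [T₀.quotKerEquivRange.finrank_eq, ZLattice.rank ℝ L,
    ← finrank_span_real_eq_finrank_int (LinearMap.range T₀), hspan,
    ← LinearMap.finrank_range_add_finrank_ker T, Nat.add_left_cancel_iff,
    ← Submodule.finrank_map_subtype_eq, ← hK, ← finrank_span_real_eq_finrank_int K] at h1
  rw [hKset]
  refine Submodule.eq_of_le_of_finrank_eq (Submodule.span_le.2 ?_) h1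
  rw [← hKset]
  exact fun x hx => hx.2

/-- A real linear isomorphism mapping one lattice into another has a finite cokernel on the
lattices. -/
theorem finite_quotient_map_lattice (L : Submodule ℤ E) [DiscreteTopology L] [IsZLattice ℝ L]
    (M : Submodule ℤ F) [DiscreteTopology M] [IsZLattice ℝ M] (e : E ≃ₗ[ℝ] F)
    (he : ∀ x ∈ L, e x ∈ M) :
    Finite (M ⧸ LinearMap.range ((e.toLinearMap.restrictScalars ℤ).restrict he)) := by
  refine Submodule.finiteQuotientOfFreeOfRankEq _ ?_
  rw [LinearMap.finrank_range_of_inj, ZLattice.rank ℝ L, ZLattice.rank ℝ M, e.finrank_eq]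
  intro a b h
  exact Subtype.ext (e.injective (congrArg (fun z : M => (z : F)) h))

end Lattice

/-- A nontrivial complex vector space is uncountable. -/
theorem subsingleton_of_countable_complex (Q : Type*) [AddCommGroup Q] [Module ℂ Q] [Countable Q] :
    Subsingleton Q := by
  by_contra h
  rw [not_subsingleton_iff_nontrivial] at h
  obtain ⟨x, hx⟩ := exists_ne (0 : Q)
  have : Countable ℂ := (smul_left_injective ℂ hx).countable
  exact not_countable_complex (Set.countable_univ)

/-! ### Analytic representations and isogenies -/

namespace ComplexTorus

variable {X : ComplexTorus.{u}} {Y : ComplexTorus.{v}} {Z : ComplexTorus.{w}}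

instance : FiniteDimensional ℝ X.space := FiniteDimensional.complexToReal X.space

theorem proj_eq_zero_iff {x : X.space} : X.proj x = 0 ↔ x ∈ X.lattice :=
  Submodule.Quotient.mk_eq_zero _

theorem proj_surjective : Function.Surjective X.proj := X.lattice.mkQ_surjective

namespace Hom

theorem ext_proj {f g : Hom X Y} (h : ∀ x, f (X.proj x) = g (X.proj x)) : f = g := by
  refine DFunLike.ext f g fun p => ?_
  obtain ⟨x, rfl⟩ := proj_surjective p
  exact h x

theorem ofLinear_proj (A : X.space →ₗ[ℂ] Y.space) (hA : ∀ x ∈ X.lattice, A x ∈ Y.lattice)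
    (x : X.space) : ofLinear A hA (X.proj x) = Y.proj (A x) := rfl

@[simp]
theorem analyticRep_ofLinear (A : X.space →ₗ[ℂ] Y.space) (hA : ∀ x ∈ X.lattice, A x ∈ Y.lattice) :
    (ofLinear A hA).analyticRep = A :=
  (analyticRep_unique _ A fun x => ofLinear_proj A hA x).symm

theorem ext_analyticRep {f g : Hom X Y} (h : f.analyticRep = g.analyticRep) : f = g :=
  ext_proj fun x => by rw [analyticRep_spec, analyticRep_spec, h]

@[simp]
theorem analyticRep_comp (g : Hom Y Z) (f : Hom X Y) :
    (g.comp f).analyticRep = g.analyticRep ∘ₗ f.analyticRep :=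
  (analyticRep_unique _ _ fun x => by
    change g (f (X.proj x)) = _
    rw [analyticRep_spec, analyticRep_spec]
    rfl).symm

@[simp]
theorem analyticRep_add (f g : Hom X Y) :
    (f + g).analyticRep = f.analyticRep + g.analyticRep :=
  (analyticRep_unique _ _ fun x => by
    change f (X.proj x) + g (X.proj x) = _
    rw [analyticRep_spec, analyticRep_spec, LinearMap.add_apply, map_add]).symm

@[simp]
theorem analyticRep_zero : (0 : Hom X Y).analyticRep = 0 :=
  (analyticRep_unique _ _ fun x => by
    rw [LinearMap.zero_apply, map_zero]
    rfl).symm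

theorem analyticRep_fst_apply (p : (X.prod Y).space) : (fst X Y).analyticRep p = p.1 :=
  LinearMap.congr_fun (analyticRep_ofLinear (X := X.prod Y) (LinearMap.fst ℂ X.space Y.space) _) p

theorem analyticRep_snd_apply (p : (X.prod Y).space) : (snd X Y).analyticRep p = p.2 :=
  LinearMap.congr_fun (analyticRep_ofLinear (X := X.prod Y) (LinearMap.snd ℂ X.space Y.space) _) p

theorem analyticRep_inl_apply (x : X.space) : (inl X Y).analyticRep x = (x, 0) :=
  LinearMap.congr_fun (analyticRep_ofLinear (Y := X.prod Y) (LinearMap.inl ℂ X.space Y.space) _) x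

theorem analyticRep_inr_apply (y : Y.space) : (inr X Y).analyticRep y = (0, y) :=
  LinearMap.congr_fun (analyticRep_ofLinear (Y := X.prod Y) (LinearMap.inr ℂ X.space Y.space) _) y

theorem analyticRep_sum_apply {X X' V : ComplexTorus.{u}} (e : Hom X V) (e' : Hom X' V)
    (x : X.space) (x' : X'.space) :
    (e.sum e').analyticRep (x, x') = e.analyticRep x + e'.analyticRep x' := by
  rw [Hom.sum, analyticRep_add, analyticRep_comp, analyticRep_comp]
  exact congrArg₂ (fun a b => e.analyticRep a + e'.analyticRep b)
    (analyticRep_fst_apply (x, x')) (analyticRep_snd_apply (x, x'))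

theorem analyticRep_prodMap_apply {X X' : ComplexTorus.{u}} {Y Y' : ComplexTorus.{v}}
    (g : Hom X Y) (g' : Hom X' Y') (x : X.space) (x' : X'.space) :
    (g.prodMap g').analyticRep (x, x') = (g.analyticRep x, g'.analyticRep x') := by
  rw [Hom.prodMap, analyticRep_add]
  simp only [analyticRep_comp, LinearMap.add_apply, LinearMap.comp_apply]
  refine (congrArg₂ (fun a b => (inl Y Y').analyticRep (g.analyticRep a) +
    (inr Y Y').analyticRep (g'.analyticRep b)) (analyticRep_fst_apply (x, x'))
    (analyticRep_snd_apply (x, x'))).trans ?_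
  refine (congrArg₂ (· + ·) (analyticRep_inl_apply (g.analyticRep x))
    (analyticRep_inr_apply (g'.analyticRep x'))).trans ?_
  exact Prod.ext (add_zero _) (zero_add _)

/-- The kernel of the analytic representation is the tangent space of the kernel, so it vanishes
if the kernel is finite: a multiple of it lies in the countable lattice. -/
theorem analyticRep_injective_of_finite_ker (f : Hom X Y)
    (hf : (f.toAddMonoidHom.ker : Set X.Point).Finite) :
    Function.Injective f.analyticRep := by
  have : Finite f.toAddMonoidHom.ker := hf
  set n := Nat.card f.toAddMonoidHom.ker
  have hn0 : n ≠ 0 := Nat.card_pos.ne'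
  have hmem : ∀ x ∈ LinearMap.ker f.analyticRep, n • x ∈ X.lattice := by
    intro x hx
    have hx' : X.proj x ∈ f.toAddMonoidHom.ker := by
      change f (X.proj x) = 0
      rw [analyticRep_spec, LinearMap.mem_ker.1 hx, map_zero]
    have h := congrArg Subtype.val (card_nsmul_eq_zero' (x := (⟨X.proj x, hx'⟩ :
      f.toAddMonoidHom.ker)))
    rw [← proj_eq_zero_iff, map_nsmul]
    exact h
  have : Countable (LinearMap.ker f.analyticRep) := by
    refine Function.Injective.countable
      (f := fun x : LinearMap.ker f.analyticRep => (⟨n • x, hmem x x.2⟩ : X.lattice)) ?_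
    intro a b h
    have h' : n • (a : X.space) = n • (b : X.space) := congrArg Subtype.val h
    rw [← Nat.cast_smul_eq_nsmul ℂ, ← Nat.cast_smul_eq_nsmul ℂ] at h'
    exact Subtype.ext (smul_right_injective _ (Nat.cast_ne_zero.2 hn0) h')
  have := subsingleton_of_countable_complex (LinearMap.ker f.analyticRep)
  exact LinearMap.ker_eq_bot.1 (Submodule.eq_bot_of_subsingleton)

theorem analyticRep_injective_of_injective (f : Hom X Y) (hf : Function.Injective f) :
    Function.Injective f.analyticRep := by
  refine f.analyticRep_injective_of_finite_ker ?_
  rw [(AddMonoidHom.ker_eq_bot_iff f.toAddMonoidHom).2 hf]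
  exact Set.finite_singleton 0

/-- The cokernel of the analytic representation of a surjective morphism is a quotient of the
countable lattice, so it vanishes. -/
theorem analyticRep_surjective_of_surjective (f : Hom X Y) (hf : Function.Surjective f) :
    Function.Surjective f.analyticRep := by
  have hsurj : Function.Surjective
      fun l : Y.lattice => (LinearMap.range f.analyticRep).mkQ (l : Y.space) := by
    intro q
    obtain ⟨y, rfl⟩ := Submodule.mkQ_surjective _ q
    obtain ⟨p, hp⟩ := hf (Y.proj y)
    obtain ⟨x, rfl⟩ := proj_surjective p
    rw [analyticRep_spec] at hp
    have hl : y - f.analyticRep x ∈ Y.lattice := by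
      rw [← proj_eq_zero_iff, map_sub, hp, sub_self]
    refine ⟨⟨_, hl⟩, ?_⟩
    change (LinearMap.range f.analyticRep).mkQ (y - f.analyticRep x) = _
    rw [map_sub, sub_eq_self]
    exact (Submodule.Quotient.mk_eq_zero _).2 ⟨x, rfl⟩
  have := hsurj.countable
  have := subsingleton_of_countable_complex (Y.space ⧸ LinearMap.range f.analyticRep)
  exact LinearMap.range_eq_top.1 (Submodule.Quotient.subsingleton_iff.1 this)

/-- A morphism whose analytic representation is bijective is an isogeny: it identifies the
kernel with a quotient of two lattices of the same rank. -/
theorem isIsogeny_of_bijective_analyticRep (f : Hom X Y)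
    (hf : Function.Bijective f.analyticRep) : f.IsIsogeny := by
  refine ⟨fun q => ?_, ?_⟩
  · obtain ⟨y, rfl⟩ := proj_surjective q
    obtain ⟨x, rfl⟩ := hf.2 y
    exact ⟨X.proj x, analyticRep_spec f x⟩
  · let e : X.space ≃ₗ[ℂ] Y.space := LinearEquiv.ofBijective f.analyticRep hf
    have he : ∀ x ∈ X.lattice, e.restrictScalars ℝ x ∈ Y.lattice := f.analyticRep_mem
    have hfin := finite_quotient_map_lattice X.lattice Y.lattice (e.restrictScalars ℝ) he
    let φ : Y.lattice →ₗ[ℤ] X.Point :=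
      X.proj ∘ₗ (e.symm.toLinearMap.restrictScalars ℤ) ∘ₗ Y.lattice.subtype
    have hφ : LinearMap.range (((e.restrictScalars ℝ).toLinearMap.restrictScalars ℤ).restrict he) ≤
        LinearMap.ker φ := by
      rintro _ ⟨x, rfl⟩
      change X.proj (e.symm (e x)) = 0
      rw [e.symm_apply_apply, proj_eq_zero_iff]
      exact x.2
    -- The kernel consists of the points `e⁻¹ l` for `l` in the lattice of `Y`.
    refine (Set.finite_range (Submodule.liftQ _ φ hφ)).subset fun p hp => ?_
    obtain ⟨x, rfl⟩ := proj_surjective p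
    have hx : e x ∈ Y.lattice := by
      rw [← proj_eq_zero_iff]
      exact (analyticRep_spec f x).symm.trans hp
    refine ⟨Submodule.Quotient.mk ⟨e x, hx⟩, ?_⟩
    change X.proj (e.symm (e x)) = X.proj x
    rw [e.symm_apply_apply]

/-- A morphism whose analytic image lies in that of an embedding factors through the embedding. -/
theorem exists_comp_eq_of_range_le {X : ComplexTorus.{u}} {Y : ComplexTorus.{v}}
    {V : ComplexTorus.{w}} (d : Hom X V) (e : Hom Y V) (he : Function.Injective e)
    (h : LinearMap.range d.analyticRep ≤ LinearMap.range e.analyticRep) :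
    ∃ a : Hom X Y, e.comp a = d := by
  let e' := LinearEquiv.ofInjective e.analyticRep (e.analyticRep_injective_of_injective he)
  let A : X.space →ₗ[ℂ] Y.space := e'.symm.toLinearMap ∘ₗ
    d.analyticRep.codRestrict _ fun x => h ⟨x, rfl⟩
  have hA : ∀ x, e.analyticRep (A x) = d.analyticRep x := fun x =>
    congrArg Subtype.val (e'.apply_symm_apply ⟨d.analyticRep x, h ⟨x, rfl⟩⟩)
  refine ⟨ofLinear A fun x hx => ?_, ext_analyticRep ?_⟩
  · rw [← proj_eq_zero_iff]
    refine he ?_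
    rw [analyticRep_spec, hA, proj_eq_zero_iff.2 (d.analyticRep_mem x hx)]
    exact (map_zero e.toAddMonoidHom).symm
  · rw [analyticRep_comp, analyticRep_ofLinear]
    exact LinearMap.ext hA

theorem comp_left_injective {X : ComplexTorus.{u}} {Y : ComplexTorus.{v}}
    {V : ComplexTorus.{w}} (e : Hom Y V) (he : Function.Injective e) {a b : Hom X Y}
    (h : e.comp a = e.comp b) : a = b :=
  DFunLike.ext a b fun p => he (DFunLike.congr_fun h p)

/-- Two embeddings with the same analytic image differ by an isomorphism. -/
theorem exists_iso_of_range_eq {X : ComplexTorus.{u}} {Y : ComplexTorus.{v}}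
    {V : ComplexTorus.{w}} (d : Hom X V) (e : Hom Y V) (hd : Function.Injective d)
    (he : Function.Injective e)
    (h : LinearMap.range d.analyticRep = LinearMap.range e.analyticRep) :
    ∃ a : Iso X Y, e.comp a.hom = d := by
  obtain ⟨a, ha⟩ := exists_comp_eq_of_range_le d e he h.le
  obtain ⟨b, hb⟩ := exists_comp_eq_of_range_le e d hd h.ge
  refine ⟨⟨a, b, comp_left_injective d hd ?_, comp_left_injective e he ?_⟩, ha⟩
  · change (d.comp b).comp a = d
    rw [hb, ha]
  · change (e.comp a).comp b = e
    rw [ha, hb]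

end Hom

end ComplexTorus

namespace ComplexTorus

variable {X : ComplexTorus.{u}} {V : ComplexTorus.{u}} {W : ComplexTorus.{v}}

/-! ### Polarizations and orthogonal complements -/

namespace Polarization

/-- For the imaginary part `B` of a positive definite hermitian form, `B(x, ix)` is `-H(x, x)`. -/
theorem exists_imForm (L : X.Polarization) : ∃ B : LinearMap.BilinForm ℝ X.space,
    (∀ x y, B x y = -B y x) ∧ (∀ x y, B x (Complex.I • y) = -B (Complex.I • x) y) ∧
    (∀ x, x ≠ 0 → B x (Complex.I • x) ≠ 0) ∧ ∀ a b : X.lattice, B a b = L.form a b := by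
  obtain ⟨H, hsymm, hpos, hL⟩ := L.exists_hermitian
  have hsmul : ∀ (c : ℝ) (x : X.space), c • x = (c : ℂ) • x := fun _ _ => rfl
  refine ⟨LinearMap.mk₂ ℝ (fun x y => (H x y).im) ?_ ?_ ?_ ?_, ?_, ?_, ?_, hL⟩
  · simp
  · intro c x y
    rw [hsmul, map_smul, LinearMap.smul_apply, smul_eq_mul, Complex.im_ofReal_mul, smul_eq_mul]
  · simp
  · intro c x y
    rw [hsmul, map_smulₛₗ, Complex.conj_ofReal, smul_eq_mul, Complex.im_ofReal_mul, smul_eq_mul]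
  · intro x y
    simp [hsymm x y]
  · intro x y
    simp
  · intro x hx
    simpa using (hpos x hx).ne'

/-- The imaginary part of a hermitian form defining the polarization, as a real bilinear form. -/
noncomputable def imForm (L : X.Polarization) : LinearMap.BilinForm ℝ X.space :=
  L.exists_imForm.choose

variable (L : X.Polarization)

theorem imForm_swap (x y : X.space) : L.imForm x y = -L.imForm y x :=
  L.exists_imForm.choose_spec.1 x y

theorem imForm_smul_I (x y : X.space) :
    L.imForm x (Complex.I • y) = -L.imForm (Complex.I • x) y :=
  L.exists_imForm.choose_spec.2.1 x y

theorem imForm_self_smul_I_ne_zero {x : X.space} (hx : x ≠ 0) : L.imForm x (Complex.I • x) ≠ 0 :=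
  L.exists_imForm.choose_spec.2.2.1 x hx

theorem imForm_lattice (a b : X.lattice) : L.imForm a b = L.form a b :=
  L.exists_imForm.choose_spec.2.2.2 a b

/-- The orthogonal complement of a complex subspace. Since the subspace is complex, orthogonality
for the hermitian form is the same as orthogonality for its imaginary part. -/
noncomputable def perp (S : Submodule ℂ X.space) : Submodule ℂ X.space where
  carrier := {x | ∀ s ∈ S, L.imForm s x = 0}
  add_mem' hx hy s hs := by rw [map_add, hx s hs, hy s hs, add_zero]
  zero_mem' s _ := map_zero _
  smul_mem' c x hx s hs := by
    have hc : c • x = c.re • x + c.im • (Complex.I • x) := by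
      have h : ∀ (r : ℝ) (y : X.space), r • y = (r : ℂ) • y := fun _ _ => rfl
      rw [h, h, smul_smul, ← add_smul, Complex.re_add_im]
    rw [hc, map_add, map_smul, map_smul, imForm_smul_I, hx s hs, hx _ (S.smul_mem _ hs)]
    simp

theorem disjoint_perp (S : Submodule ℂ X.space) : Disjoint S (L.perp S) := by
  rw [Submodule.disjoint_def]
  intro x hx hx'
  by_contra h
  exact L.imForm_self_smul_I_ne_zero h ((L.perp S).smul_mem _ hx' x hx)

theorem isCompl_perp (S : Submodule ℂ X.space) : IsCompl S (L.perp S) := by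
  have hrefl : L.imForm.IsRefl := fun x y h => by rw [imForm_swap, h, neg_zero]
  have h := (LinearMap.BilinForm.isCompl_orthogonal_iff_disjoint (W := S.restrictScalars ℝ)
    hrefl).2 (by
      rw [Submodule.disjoint_def]
      exact fun x hx hx' => Submodule.disjoint_def.1 (L.disjoint_perp S) x hx hx')
  refine ⟨L.disjoint_perp S, codisjoint_iff.2 ?_⟩
  rw [Submodule.eq_top_iff']
  intro x
  have hx : x ∈ S.restrictScalars ℝ ⊔ L.imForm.orthogonal (S.restrictScalars ℝ) := by
    rw [h.sup_eq_top]
    trivial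
  obtain ⟨s, hs, t, ht, rfl⟩ := Submodule.mem_sup.1 hx
  exact Submodule.add_mem_sup (S := S) (T := L.perp S) hs ht

/-- A subspace which is contained in the orthogonal complement of `S` and spans the whole space
together with `S` is the orthogonal complement. -/
theorem eq_perp_of_le {S T : Submodule ℂ X.space} (h : T ≤ L.perp S) (hST : S ⊔ T = ⊤) :
    T = L.perp S :=
  eq_of_le_of_inf_le_of_sup_le h (z := S)
    (by rw [inf_comm, (L.isCompl_perp S).inf_eq_bot]; exact bot_le)
    (by rw [sup_comm T, hST]; exact le_top)

end Polarization

/-! ### Subtori -/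

/-- A complex subspace is rational if it is spanned over `ℝ` by lattice vectors; these are the
tangent spaces of the subtori. -/
def IsRational (S : Submodule ℂ X.space) : Prop :=
  Submodule.span ℝ {x | x ∈ X.lattice ∧ x ∈ S} = S.restrictScalars ℝ

theorem Hom.isRational_ker (f : Hom V W) : IsRational (LinearMap.ker f.analyticRep) :=
  span_lattice_inf_ker V.lattice W.lattice (f.analyticRep.restrictScalars ℝ) f.analyticRep_mem

theorem Hom.isRational_range (f : Hom V W) : IsRational (LinearMap.range f.analyticRep) := by
  refine le_antisymm (Submodule.span_le.2 fun x hx => hx.2) ?_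
  rintro _ ⟨x, rfl⟩
  have hx : x ∈ Submodule.span ℝ (V.lattice : Set V.space) := by
    rw [IsZLattice.span_top]
    trivial
  refine Submodule.span_induction (p := fun x _ => f.analyticRep x ∈ Submodule.span ℝ _)
    ?_ ?_ ?_ ?_ hx
  · exact fun y hy => Submodule.subset_span ⟨f.analyticRep_mem y hy, ⟨y, rfl⟩⟩
  · rw [map_zero]
    exact zero_mem _
  · intro a b _ _ ha hb
    rw [map_add]
    exact add_mem ha hb
  · intro c a _ ha
    rw [show f.analyticRep (c • a) = c • f.analyticRep a from
      (f.analyticRep.restrictScalars ℝ).map_smul c a]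
    exact Submodule.smul_mem _ _ ha

/-- The orthogonal complement of a rational subspace is cut out by finitely many linear forms
which are integral on the lattice, so it is rational. -/
theorem Polarization.isRational_perp (L : X.Polarization) {S : Submodule ℂ X.space}
    (hS : IsRational S) : IsRational (L.perp S) := by
  obtain ⟨t, ht, hspan⟩ := (Submodule.fg_span_iff_fg_span_finset_subset
    {x | x ∈ X.lattice ∧ x ∈ S}).1 (IsNoetherian.noetherian (R := ℝ) _)
  let T : X.space →ₗ[ℝ] t → ℝ := LinearMap.pi fun s => L.imForm s
  have hker : ∀ x, T x = 0 ↔ x ∈ L.perp S := by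
    intro x
    constructor
    · intro hx s hs
      have hs' : s ∈ Submodule.span ℝ (t : Set X.space) := by
        rw [← hspan, hS]
        exact hs
      refine Submodule.span_induction (p := fun s _ => L.imForm s x = 0) ?_ ?_ ?_ ?_ hs'
      · exact fun y hy => congrFun hx ⟨y, hy⟩
      · simp
      · intro a b _ _ ha hb
        simp [ha, hb]
      · intro c a _ ha
        simp [ha]
    · intro hx
      ext s
      exact hx s (ht s.2).2
  have hT : ∀ x ∈ X.lattice, T x ∈ Submodule.span ℤ (Set.range (Pi.basisFun ℝ t)) := by
    intro x hx
    rw [Module.Basis.mem_span_iff_repr_mem]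
    intro s
    exact ⟨L.form ⟨s, (ht s.2).1⟩ ⟨x, hx⟩, (L.imForm_lattice ⟨s, (ht s.2).1⟩ ⟨x, hx⟩).symm⟩
  have h := span_lattice_inf_ker X.lattice _ T hT
  have hk : LinearMap.ker T = (L.perp S).restrictScalars ℝ := Submodule.ext hker
  rw [IsRational, ← hk, ← h]
  simp only [hker]

theorem discreteTopology_comap_subtype (S : Submodule ℂ X.space) :
    DiscreteTopology (X.lattice.comap (S.subtype.restrictScalars ℤ)) :=
  DiscreteTopology.of_continuous_injective
    (f := fun y : X.lattice.comap (S.subtype.restrictScalars ℤ) =>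
      (⟨(y : S), y.2⟩ : X.lattice)) (by fun_prop)
    fun _ _ h => Subtype.ext (Subtype.ext (congrArg (fun z : X.lattice => (z : X.space)) h))

/-- The subtorus with a given rational tangent space. -/
noncomputable def subtorus (S : Submodule ℂ X.space) (hS : IsRational S) : ComplexTorus.{u} where
  space := S
  lattice := X.lattice.comap (S.subtype.restrictScalars ℤ)
  discreteTopology := discreteTopology_comap_subtype S
  isZLattice := by
    have := discreteTopology_comap_subtype S
    refine ⟨?_⟩
    have hinj : Function.Injective (S.subtype.restrictScalars ℝ) := Subtype.val_injective
    refine Submodule.map_injective_of_injective hinj ?_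
    rw [Submodule.map_span, Submodule.map_top]
    have himage : S.subtype.restrictScalars ℝ '' (X.lattice.comap (S.subtype.restrictScalars ℤ)) =
        {x | x ∈ X.lattice ∧ x ∈ S} := by
      ext x
      constructor
      · rintro ⟨y, hy, rfl⟩
        exact ⟨hy, y.2⟩
      · rintro ⟨hx, hx'⟩
        exact ⟨⟨x, hx'⟩, hx, rfl⟩
    rw [himage, hS]
    ext x
    simp

/-- The embedding of a subtorus. -/
noncomputable def subtorusIncl (S : Submodule ℂ X.space) (hS : IsRational S) :
    Hom (subtorus S hS) X :=
  Hom.ofLinear (X := subtorus S hS) S.subtype fun _ h => h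

theorem analyticRep_subtorusIncl (S : Submodule ℂ X.space) (hS : IsRational S) :
    (subtorusIncl S hS).analyticRep = S.subtype :=
  Hom.analyticRep_ofLinear (X := subtorus S hS) _ _

theorem subtorusIncl_injective (S : Submodule ℂ X.space) (hS : IsRational S) :
    Function.Injective (subtorusIncl S hS) := by
  refine (injective_iff_map_eq_zero (subtorusIncl S hS).toAddMonoidHom).2 fun p hp => ?_
  obtain ⟨x, rfl⟩ := proj_surjective p
  have h : X.proj (S.subtype x) = 0 := hp
  exact (proj_eq_zero_iff (X := subtorus S hS)).2 (proj_eq_zero_iff (X := X).1 h)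

/-- A morphism with injective analytic representation pulls polarizations back to
polarizations. -/
theorem IsAbelianVariety.of_injective {X Y : ComplexTorus.{u}} (L : Y.Polarization) (e : Hom X Y)
    (he : Function.Injective e.analyticRep) : X.IsAbelianVariety := by
  obtain ⟨H, hsymm, hpos, hL⟩ := L.exists_hermitian
  let H' : X.space →ₗ[ℂ] X.space →ₗ⋆[ℂ] ℂ := (H ∘ₗ e.analyticRep).compl₂ e.analyticRep
  refine ⟨⟨e.pullback L.form, H', fun x y => hsymm _ _,
    fun x hx => hpos _ ?_, fun a b => hL (e.homology a) (e.homology b)⟩⟩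
  exact (map_ne_zero_iff _ he).2 hx

/-- The abelian subvariety with a given rational tangent space. -/
noncomputable def Polarization.abelianSubvariety (L : X.Polarization) (S : Submodule ℂ X.space)
    (hS : IsRational S) : AbelianSubvariety X where
  torus := subtorus S hS
  isAbelianVariety := IsAbelianVariety.of_injective L (subtorusIncl S hS)
    (Hom.analyticRep_injective_of_injective _ (subtorusIncl_injective S hS))
  incl := subtorusIncl S hS
  incl_injective := subtorusIncl_injective S hS

end ComplexTorus

namespace ComplexTorus

variable {V : ComplexTorus.{u}} {W : ComplexTorus.{v}}

/-! ### Complementary subvarieties -/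

theorem Polarization.imForm_analyticRep {X Y : ComplexTorus.{u}} (L : Y.Polarization)
    (e : Hom X Y) (a b : X.lattice) :
    L.imForm (e.analyticRep a) (e.analyticRep b) = e.pullback L.form a b :=
  L.imForm_lattice (e.homology a) (e.homology b)

/-- A real linear form vanishing on the lattice is zero. -/
theorem eq_zero_of_forall_lattice {X : ComplexTorus.{u}} (T : X.space →ₗ[ℝ] ℝ)
    (hT : ∀ x ∈ X.lattice, T x = 0) (x : X.space) : T x = 0 := by
  have h : Submodule.span ℝ (X.lattice : Set X.space) ≤ LinearMap.ker T := Submodule.span_le.2 hT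
  rw [IsZLattice.span_top] at h
  exact h trivial

namespace AbelianSubvariety

/-- The tangent space of an abelian subvariety, as a subspace of that of the ambient variety. -/
noncomputable def tangent (X : AbelianSubvariety V) : Submodule ℂ V.space :=
  LinearMap.range X.incl.analyticRep

/-- The splitting of the form on `X × X'` means that the tangent spaces are orthogonal. -/
theorem pullback_sum_eq_iff (L : V.Polarization) (X X' : AbelianSubvariety V) :
    (X.incl.sum X'.incl).pullback L.form =
      (Hom.fst X.torus X'.torus).pullback (X.incl.pullback L.form) +
      (Hom.snd X.torus X'.torus).pullback (X'.incl.pullback L.form) ↔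
    X'.tangent ≤ L.perp X.tangent := by
  -- The two sides differ by the two mixed terms, which agree up to sign.
  have hdiff : ∀ p q : (X.torus.prod X'.torus).lattice,
      ((X.incl.sum X'.incl).pullback L.form p q : ℝ) =
        ((((Hom.fst X.torus X'.torus).pullback (X.incl.pullback L.form) +
          (Hom.snd X.torus X'.torus).pullback (X'.incl.pullback L.form)) p q : ℤ) : ℝ) +
        (L.imForm (X.incl.analyticRep p.1.1) (X'.incl.analyticRep q.1.2) -
          L.imForm (X.incl.analyticRep q.1.1) (X'.incl.analyticRep p.1.2)) := by
    intro p q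
    have h1 : (((Hom.fst X.torus X'.torus).pullback (X.incl.pullback L.form) p q : ℤ) : ℝ) =
        L.imForm (X.incl.analyticRep p.1.1) (X.incl.analyticRep q.1.1) := by
      refine (L.imForm_analyticRep X.incl ((Hom.fst X.torus X'.torus).homology p)
        ((Hom.fst X.torus X'.torus).homology q)).symm.trans ?_
      exact congrArg₂ (fun a b => L.imForm (X.incl.analyticRep a) (X.incl.analyticRep b))
        (Hom.analyticRep_fst_apply p.1) (Hom.analyticRep_fst_apply q.1)
    have h2 : (((Hom.snd X.torus X'.torus).pullback (X'.incl.pullback L.form) p q : ℤ) : ℝ) =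
        L.imForm (X'.incl.analyticRep p.1.2) (X'.incl.analyticRep q.1.2) := by
      refine (L.imForm_analyticRep X'.incl ((Hom.snd X.torus X'.torus).homology p)
        ((Hom.snd X.torus X'.torus).homology q)).symm.trans ?_
      exact congrArg₂ (fun a b => L.imForm (X'.incl.analyticRep a) (X'.incl.analyticRep b))
        (Hom.analyticRep_snd_apply p.1) (Hom.analyticRep_snd_apply q.1)
    have h3 : (((X.incl.sum X'.incl).pullback L.form p q : ℤ) : ℝ) =
        L.imForm (X.incl.analyticRep p.1.1 + X'.incl.analyticRep p.1.2)
          (X.incl.analyticRep q.1.1 + X'.incl.analyticRep q.1.2) := by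
      refine (L.imForm_analyticRep (X.incl.sum X'.incl) p q).symm.trans ?_
      exact congrArg₂ (fun a b => L.imForm a b)
        (Hom.analyticRep_sum_apply X.incl X'.incl p.1.1 p.1.2)
        (Hom.analyticRep_sum_apply X.incl X'.incl q.1.1 q.1.2)
    rw [h3, LinearMap.add_apply, LinearMap.add_apply, Int.cast_add, h1, h2, map_add, map_add,
      LinearMap.add_apply, LinearMap.add_apply,
      L.imForm_swap (X'.incl.analyticRep p.1.2) (X.incl.analyticRep q.1.1)]
    ring
  constructor
  · intro h
    have horth : ∀ a ∈ X.torus.lattice, ∀ b ∈ X'.torus.lattice,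
        L.imForm (X.incl.analyticRep a) (X'.incl.analyticRep b) = 0 := by
      intro a ha b hb
      -- On the lattice vectors `(a, 0)` and `(0, b)` only one mixed term survives.
      have h0 := hdiff ⟨(a, 0), ha, zero_mem _⟩ ⟨(0, b), zero_mem _, hb⟩
      rw [h] at h0
      simpa using h0
    rintro _ ⟨b, rfl⟩ _ ⟨a, rfl⟩
    refine eq_zero_of_forall_lattice ((L.imForm.flip (X'.incl.analyticRep b)) ∘ₗ
      X.incl.analyticRep.restrictScalars ℝ) (fun a ha => ?_) a
    exact eq_zero_of_forall_lattice ((L.imForm (X.incl.analyticRep a)) ∘ₗ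
      X'.incl.analyticRep.restrictScalars ℝ) (fun b hb => horth a ha b hb) b
  · intro h
    have horth : ∀ a b, L.imForm (X.incl.analyticRep a) (X'.incl.analyticRep b) = 0 :=
      fun a b => h ⟨b, rfl⟩ _ ⟨a, rfl⟩
    refine LinearMap.ext₂ fun p q => ?_
    have h0 := hdiff p q
    rw [horth, horth, sub_zero, add_zero] at h0
    exact_mod_cast h0

/-- Complementary abelian subvarieties are those whose tangent spaces are orthogonal
complements. -/
theorem areComplementary_iff (L : V.Polarization) (X X' : AbelianSubvariety V) :
    AreComplementary L X X' ↔ X'.tangent = L.perp X.tangent := by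
  rw [AreComplementary, pullback_sum_eq_iff]
  constructor
  · rintro ⟨hs, h⟩
    refine L.eq_perp_of_le h (Submodule.eq_top_iff'.2 fun v => ?_)
    obtain ⟨⟨x, x'⟩, rfl⟩ := Hom.analyticRep_surjective_of_surjective _ hs.1 v
    rw [Hom.analyticRep_sum_apply]
    exact Submodule.add_mem_sup ⟨x, rfl⟩ ⟨x', rfl⟩
  · intro h
    refine ⟨Hom.isIsogeny_of_bijective_analyticRep _ ⟨?_, fun v => ?_⟩, h.le⟩
    · refine (injective_iff_map_eq_zero _).2 ?_
      rintro ⟨x, x'⟩ hx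
      rw [Hom.analyticRep_sum_apply] at hx
      have h0 : X.incl.analyticRep x = 0 := by
        refine Submodule.disjoint_def.1 (L.disjoint_perp X.tangent) _ ⟨x, rfl⟩ ?_
        rw [eq_neg_of_add_eq_zero_left hx, ← h]
        exact neg_mem ⟨x', rfl⟩
      rw [h0, zero_add] at hx
      have hinj := X.incl.analyticRep_injective_of_injective X.incl_injective
      have hinj' := X'.incl.analyticRep_injective_of_injective X'.incl_injective
      exact Prod.ext (hinj (h0.trans (map_zero _).symm)) (hinj' (hx.trans (map_zero _).symm))
    · have hv : v ∈ X.tangent ⊔ X'.tangent := by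
        rw [h, (L.isCompl_perp X.tangent).sup_eq_top]
        trivial
      obtain ⟨_, ⟨x, rfl⟩, _, ⟨x', rfl⟩, rfl⟩ := Submodule.mem_sup.1 hv
      exact ⟨(x, x'), Hom.analyticRep_sum_apply _ _ x x'⟩

end AbelianSubvariety

theorem Polarization.perp_perp (L : V.Polarization) (S : Submodule ℂ V.space) :
    L.perp (L.perp S) = S := by
  refine (L.eq_perp_of_le (fun x hx s hs => ?_) ?_).symm
  · rw [L.imForm_swap, hs x hx, neg_zero]
  · rw [sup_comm, (L.isCompl_perp S).sup_eq_top]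

theorem Polarization.tangent_abelianSubvariety (L : V.Polarization) (S : Submodule ℂ V.space)
    (hS : IsRational S) : (L.abelianSubvariety S hS).tangent = S :=
  (congrArg LinearMap.range (analyticRep_subtorusIncl S hS)).trans S.range_subtype

/-! ### Poincaré decompositions -/

/-- The commutativity of the square of a Poincaré decomposition, on tangent spaces. -/
theorem Hom.comp_sum_eq_iff {X X' : ComplexTorus.{u}} {Y Y' : ComplexTorus.{v}} (f : Hom V W)
    (e : Hom X V) (e' : Hom X' V) (i : Hom Y W) (i' : Hom Y' W) (g : Hom X Y) :
    f.comp (e.sum e') = (i.sum i').comp (g.prodMap 0) ↔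
      ∀ x x', f.analyticRep (e.analyticRep x + e'.analyticRep x') =
        i.analyticRep (g.analyticRep x) := by
  have h1 : ∀ x x', (f.comp (e.sum e')).analyticRep (x, x') =
      f.analyticRep (e.analyticRep x + e'.analyticRep x') := by
    intro x x'
    rw [analyticRep_comp, LinearMap.comp_apply, analyticRep_sum_apply]
  have h2 : ∀ (x : X.space) (x' : X'.space), ((i.sum i').comp (g.prodMap 0)).analyticRep (x, x') =
      i.analyticRep (g.analyticRep x) := by
    intro x x'
    rw [analyticRep_comp, LinearMap.comp_apply, analyticRep_prodMap_apply, analyticRep_sum_apply]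
    simp
  constructor
  · intro h x x'
    rw [← h1, ← h2 x x', h]
  · intro h
    refine ext_analyticRep (LinearMap.ext fun p => ?_)
    exact (h1 p.1 p.2).trans ((h p.1 p.2).trans (h2 p.1 p.2).symm)

namespace PoincareDecomposition

variable {LV : V.Polarization} {LW : W.Polarization} {f : Hom V W}

theorem analyticRep_incl_X (D : PoincareDecomposition LV LW f) (x : D.X.torus.space) :
    f.analyticRep (D.X.incl.analyticRep x) = D.Y.incl.analyticRep (D.g.analyticRep x) := by
  simpa using (Hom.comp_sum_eq_iff f _ _ _ _ _).1 D.comm x 0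

theorem analyticRep_incl_X' (D : PoincareDecomposition LV LW f) (x' : D.X'.torus.space) :
    f.analyticRep (D.X'.incl.analyticRep x') = 0 := by
  simpa using (Hom.comp_sum_eq_iff f _ _ _ _ _).1 D.comm 0 x'

theorem exists_add_eq (D : PoincareDecomposition LV LW f) (v : V.space) :
    ∃ x x', D.X.incl.analyticRep x + D.X'.incl.analyticRep x' = v := by
  obtain ⟨⟨x, x'⟩, h⟩ := Hom.analyticRep_surjective_of_surjective _ D.complementary_domain.1.1 v
  exact ⟨x, x', (Hom.analyticRep_sum_apply _ _ x x').symm.trans h⟩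

/-- `f` vanishes on `X'`, and is injective on tangent vectors of `X` because `g` has a finite
kernel and `Y` is embedded. -/
theorem tangent_X'_eq_ker (D : PoincareDecomposition LV LW f) :
    D.X'.tangent = LinearMap.ker f.analyticRep := by
  apply le_antisymm
  · rintro _ ⟨x', rfl⟩
    exact D.analyticRep_incl_X' x'
  · intro v hv
    obtain ⟨x, x', rfl⟩ := D.exists_add_eq v
    rw [LinearMap.mem_ker, map_add, analyticRep_incl_X, analyticRep_incl_X', add_zero] at hv
    have hg := D.g.analyticRep_injective_of_finite_ker D.isIsogeny_g.2
    have hi := D.Y.incl.analyticRep_injective_of_injective D.Y.incl_injective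
    have hx : x = 0 := (map_eq_zero_iff _ hg).1 ((map_eq_zero_iff _ hi).1 hv)
    rw [hx, map_zero, zero_add]
    exact ⟨x', rfl⟩

theorem tangent_X_eq_perp_ker (D : PoincareDecomposition LV LW f) :
    D.X.tangent = LV.perp (LinearMap.ker f.analyticRep) := by
  rw [← D.tangent_X'_eq_ker, (AbelianSubvariety.areComplementary_iff _ _ _).1
    D.complementary_domain, LV.perp_perp]

/-- The image of `f` is that of `g`, and `g` is surjective. -/
theorem tangent_Y_eq_range (D : PoincareDecomposition LV LW f) :
    D.Y.tangent = LinearMap.range f.analyticRep := by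
  apply le_antisymm
  · rintro _ ⟨y, rfl⟩
    obtain ⟨x, rfl⟩ := Hom.analyticRep_surjective_of_surjective _ D.isIsogeny_g.1 y
    exact ⟨_, D.analyticRep_incl_X x⟩
  · rintro _ ⟨v, rfl⟩
    obtain ⟨x, x', rfl⟩ := D.exists_add_eq v
    rw [map_add, analyticRep_incl_X, analyticRep_incl_X', add_zero]
    exact ⟨_, rfl⟩

theorem tangent_Y'_eq_perp_range (D : PoincareDecomposition LV LW f) :
    D.Y'.tangent = LW.perp (LinearMap.range f.analyticRep) := by
  rw [← D.tangent_Y_eq_range]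
  exact (AbelianSubvariety.areComplementary_iff _ _ _).1 D.complementary_codomain

theorem comp_incl_X (D : PoincareDecomposition LV LW f) :
    f.comp D.X.incl = D.Y.incl.comp D.g :=
  Hom.ext_analyticRep (LinearMap.ext fun x => by
    rw [Hom.analyticRep_comp, Hom.analyticRep_comp]
    exact D.analyticRep_incl_X x)

end PoincareDecomposition

theorem AbelianSubvariety.exists_iso_of_tangent_eq {X₁ X₂ : AbelianSubvariety V}
    (h : X₁.tangent = X₂.tangent) : ∃ a : Iso X₁.torus X₂.torus, X₂.incl.comp a.hom = X₁.incl :=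
  Hom.exists_iso_of_range_eq _ _ X₁.incl_injective X₂.incl_injective h

/-- The kernel and the image of the analytic representation, with their orthogonal complements,
are the tangent spaces of a Poincaré decomposition. -/
theorem nonempty_poincareDecomposition (LV : V.Polarization) (LW : W.Polarization) (f : Hom V W) :
    Nonempty (PoincareDecomposition LV LW f) := by
  have hK := f.isRational_ker
  have hR := f.isRational_range
  set K := LinearMap.ker f.analyticRep
  set R := LinearMap.range f.analyticRep
  let X := LV.abelianSubvariety (LV.perp K) (LV.isRational_perp hK)
  let X' := LV.abelianSubvariety K hK
  let Y := LW.abelianSubvariety R hR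
  let Y' := LW.abelianSubvariety (LW.perp R) (LW.isRational_perp hR)
  have hX : X.tangent = LV.perp K := LV.tangent_abelianSubvariety _ _
  have hX' : X'.tangent = K := LV.tangent_abelianSubvariety _ _
  have hY : Y.tangent = R := LW.tangent_abelianSubvariety _ _
  have hY' : Y'.tangent = LW.perp R := LW.tangent_abelianSubvariety _ _
  obtain ⟨g, hg⟩ := Hom.exists_comp_eq_of_range_le (f.comp X.incl) Y.incl Y.incl_injective (by
    change _ ≤ Y.tangent
    rw [hY, Hom.analyticRep_comp]
    exact LinearMap.range_comp_le_range _ _)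
  have hg' : ∀ x, Y.incl.analyticRep (g.analyticRep x) =
      f.analyticRep (X.incl.analyticRep x) := by
    intro x
    have h := LinearMap.congr_fun (congrArg Hom.analyticRep hg) x
    rwa [Hom.analyticRep_comp, Hom.analyticRep_comp] at h
  have hker : ∀ x', f.analyticRep (X'.incl.analyticRep x') = 0 := by
    intro x'
    have h : X'.incl.analyticRep x' ∈ X'.tangent := ⟨x', rfl⟩
    rw [hX'] at h
    exact h
  have hiX := X.incl.analyticRep_injective_of_injective X.incl_injective
  have hiY := Y.incl.analyticRep_injective_of_injective Y.incl_injective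
  refine ⟨⟨X, X', Y, Y', (AbelianSubvariety.areComplementary_iff _ _ _).2 ?_,
    (AbelianSubvariety.areComplementary_iff _ _ _).2 ?_, g,
    g.isIsogeny_of_bijective_analyticRep ⟨?_, ?_⟩, (Hom.comp_sum_eq_iff _ _ _ _ _ _).2 ?_⟩⟩
  · rw [hX, hX', LV.perp_perp]
  · rw [hY, hY']
  · refine (injective_iff_map_eq_zero _).2 fun x hx => ?_
    have h := hg' x
    rw [hx, map_zero] at h
    refine (map_eq_zero_iff _ hiX).1 (Submodule.disjoint_def.1 (LV.disjoint_perp K) _ h.symm ?_)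
    rw [← hX]
    exact ⟨x, rfl⟩
  · intro y
    have hy : Y.incl.analyticRep y ∈ Y.tangent := ⟨y, rfl⟩
    rw [hY] at hy
    obtain ⟨v, hv⟩ := hy
    have hv' : v ∈ X.tangent ⊔ X'.tangent := by
      rw [hX, hX', sup_comm, (LV.isCompl_perp K).sup_eq_top]
      trivial
    obtain ⟨_, ⟨x, rfl⟩, _, ⟨x', rfl⟩, rfl⟩ := Submodule.mem_sup.1 hv'
    refine ⟨x, hiY ?_⟩
    rw [hg', ← hv, map_add, hker, add_zero]
  · intro x x'
    rw [map_add, hker, add_zero, hg']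

end ComplexTorus

theorem mainTheorem8 {V : ComplexTorus.{u}} {W : ComplexTorus.{v}}
    (LV : V.Polarization) (LW : W.Polarization) (f : ComplexTorus.Hom V W) :
    Nonempty (ComplexTorus.PoincareDecomposition LV LW f) ∧
    ∀ D₁ D₂ : ComplexTorus.PoincareDecomposition LV LW f,
      ∃ (a : ComplexTorus.Iso D₁.X.torus D₂.X.torus)
        (a' : ComplexTorus.Iso D₁.X'.torus D₂.X'.torus)
        (b : ComplexTorus.Iso D₁.Y.torus D₂.Y.torus)
        (b' : ComplexTorus.Iso D₁.Y'.torus D₂.Y'.torus),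
        D₂.X.incl.comp a.hom = D₁.X.incl ∧
        D₂.X'.incl.comp a'.hom = D₁.X'.incl ∧
        D₂.Y.incl.comp b.hom = D₁.Y.incl ∧
        D₂.Y'.incl.comp b'.hom = D₁.Y'.incl ∧
        D₂.g.comp a.hom = b.hom.comp D₁.g := by
  refine ⟨ComplexTorus.nonempty_poincareDecomposition LV LW f, fun D₁ D₂ => ?_⟩
  obtain ⟨a, ha⟩ := ComplexTorus.AbelianSubvariety.exists_iso_of_tangent_eq
    (D₁.tangent_X_eq_perp_ker.trans D₂.tangent_X_eq_perp_ker.symm)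
  obtain ⟨a', ha'⟩ := ComplexTorus.AbelianSubvariety.exists_iso_of_tangent_eq
    (D₁.tangent_X'_eq_ker.trans D₂.tangent_X'_eq_ker.symm)
  obtain ⟨b, hb⟩ := ComplexTorus.AbelianSubvariety.exists_iso_of_tangent_eq
    (D₁.tangent_Y_eq_range.trans D₂.tangent_Y_eq_range.symm)
  obtain ⟨b', hb'⟩ := ComplexTorus.AbelianSubvariety.exists_iso_of_tangent_eq
    (D₁.tangent_Y'_eq_perp_range.trans D₂.tangent_Y'_eq_perp_range.symm)
  refine ⟨a, a', b, b', ha, ha', hb, hb', ?_⟩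
  -- Both sides become `f` restricted to `D₁.X` after the embedding of `D₂.Y`.
  refine ComplexTorus.Hom.comp_left_injective _ D₂.Y.incl_injective ?_
  change (D₂.Y.incl.comp D₂.g).comp a.hom = (D₂.Y.incl.comp b.hom).comp D₁.g
  rw [hb, ← D₁.comp_incl_X, ← D₂.comp_incl_X, ← ha]
  rfl
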